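/- For an integer $p\ge 3$ let $\Gamma_p$ be the Hecke group, i.e. the group of Möbius transformations of the upper half-plane generated by $\iota: z\mapsto -1/z$ and $\alpha_p: z\mapsto z+2\cos(\pi/p)$, and let $\gamma=\iota\alpha_p$, so that $\Gamma_p=\langle \iota,\gamma\mid \iota^2=\gamma^p=1\rangle$. The word length of $g\in\Gamma_p$ is the least number of letters in a word in $\iota,\gamma,\gamma^{-1}$ representing $g$, and the word length of a conjugacy class is the least word length of its elements. An element of infinite order of $\Gamma_p$ is called reciprocal if it is conjugate in $\Gamma_p$ to its inverse, and an element $g\in\Gamma_p$ is called primitive if $g=b^k$ with $b\in\Gamma_p$ and $k\in\mathbb{Z}$ implies $k=\pm1$. A conjugacy class is a reciprocal class if it contains a reciprocal element, and a primitive reciprocal class if it contains a primitive reciprocal element. For real $x$ let $W_x$ and $W^p_x$ be the sets of reciprocal classes and of primitive reciprocal classes, respectively, of $\Gamma_p$ of word length at most $x$. Then, for every integer $p\ge 3$, $|W^p_x|\sim|W_x|$ as $x\to\infty$, that is, \[\lim_{x\to\infty}\frac{|W^p_x|}{|W_x|}=1.\] -/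

import Mathlib

open scoped UpperHalfPlane MatrixGroups

namespace Hecke

noncomputable def inversionMatrix : SL(2, ℝ) :=
  ⟨!![0, -1; 1, 0], by simp [Matrix.det_fin_two]⟩

noncomputable def translationMatrix (p : ℕ) : SL(2, ℝ) :=
  ⟨!![1, 2 * Real.cos (Real.pi / p); 0, 1], by simp [Matrix.det_fin_two]⟩

/-- The Möbius transformation `z ↦ -1 / z` of the upper half-plane. -/
noncomputable def inversion : Equiv.Perm ℍ :=
  MulAction.toPermHom SL(2, ℝ) ℍ inversionMatrix

/-- The Möbius transformation `z ↦ z + 2 cos (π / p)` of the upper half-plane. -/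
noncomputable def translation (p : ℕ) : Equiv.Perm ℍ :=
  MulAction.toPermHom SL(2, ℝ) ℍ (translationMatrix p)

theorem coe_inversion (z : ℍ) : ((inversion z : ℍ) : ℂ) = -1 / (z : ℂ) := by
  rw [inversion, MulAction.toPermHom_apply, MulAction.toPerm_apply,
    UpperHalfPlane.specialLinearGroup_apply]
  simp [inversionMatrix]

theorem coe_translation (p : ℕ) (z : ℍ) :
    ((translation p z : ℍ) : ℂ) = (z : ℂ) + ((2 * Real.cos (Real.pi / p) : ℝ) : ℂ) := by
  rw [translation, MulAction.toPermHom_apply, MulAction.toPerm_apply,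
    UpperHalfPlane.specialLinearGroup_apply]
  simp [translationMatrix]

/-- The Hecke group `Γ_p`: the group of Möbius transformations of the upper half-plane
generated by `z ↦ -1 / z` and `z ↦ z + 2 cos (π / p)`. -/
def heckeGroup (p : ℕ) : Subgroup (Equiv.Perm ℍ) :=
  Subgroup.closure {inversion, translation p}

/-- The generator `ι : z ↦ -1 / z`, as an element of `Γ_p`. -/
noncomputable def iota (p : ℕ) : heckeGroup p :=
  ⟨inversion, Subgroup.subset_closure (by simp)⟩

/-- The generator `α_p : z ↦ z + 2 cos (π / p)`, as an element of `Γ_p`. -/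
noncomputable def alpha (p : ℕ) : heckeGroup p :=
  ⟨translation p, Subgroup.subset_closure (by simp)⟩

/-- The element `γ = ι α_p : z ↦ -1 / (z + 2 cos (π / p))` of `Γ_p`. -/
noncomputable def gamma (p : ℕ) : heckeGroup p := iota p * alpha p

/-- `w` is a word in the generators `ι`, `γ` of `Γ_p` and the inverse of `γ`
(`ι` is its own inverse). -/
def IsWord {p : ℕ} (w : List (heckeGroup p)) : Prop :=
  ∀ s ∈ w, s = iota p ∨ s = gamma p ∨ s = (gamma p)⁻¹

/-- The word length of `g ∈ Γ_p` with respect to `ι` and `γ`: the least number of letters in a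
word in `ι`, `γ`, `γ⁻¹` that represents `g`. -/
noncomputable def wordLength {p : ℕ} (g : heckeGroup p) : ℕ :=
  sInf {n : ℕ | ∃ w : List (heckeGroup p), IsWord w ∧ w.prod = g ∧ w.length = n}

/-- The length of a conjugacy class of `Γ_p`: the least word length of its elements. -/
noncomputable def classLength {p : ℕ} (c : ConjClasses (heckeGroup p)) : ℕ :=
  sInf (wordLength '' c.carrier)

/-- An element of a group is reciprocal if it has infinite order and is conjugate to its
inverse. -/
def IsReciprocal {G : Type*} [Group G] (g : G) : Prop :=
  ¬ IsOfFinOrder g ∧ ∃ h : G, h * g * h⁻¹ = g⁻¹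

/-- An element of a group is primitive if it is not a proper power, that is, if it can be written
as `b ^ k` only with `k = 1` or `k = -1`. -/
def IsPrimitive {G : Type*} [Group G] (g : G) : Prop :=
  ∀ (b : G) (k : ℤ), b ^ k = g → k = 1 ∨ k = -1

/-- The reciprocal classes of `Γ_p` of length at most `x`. -/
def reciprocalClasses (p : ℕ) (x : ℝ) : Set (ConjClasses (heckeGroup p)) :=
  {c | (∃ g ∈ c.carrier, IsReciprocal g) ∧ (classLength c : ℝ) ≤ x}

/-- The primitive reciprocal classes of `Γ_p` of length at most `x`. -/
def primitiveReciprocalClasses (p : ℕ) (x : ℝ) : Set (ConjClasses (heckeGroup p)) :=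
  {c | (∃ g ∈ c.carrier, IsReciprocal g ∧ IsPrimitive g) ∧ (classLength c : ℝ) ≤ x}

theorem iota_mul_self (p : ℕ) : iota p * iota p = 1 := by
  apply Subtype.ext
  apply Equiv.ext
  intro z
  apply UpperHalfPlane.ext
  change ((inversion (inversion z) : ℍ) : ℂ) = z
  rw [coe_inversion, coe_inversion]
  have := z.ne_zero
  field_simp

/-- Every element of `Γ_p` is represented by a word, so that word lengths are genuine minima. -/
theorem exists_isWord {p : ℕ} (g : heckeGroup p) :
    ∃ w : List (heckeGroup p), IsWord w ∧ w.prod = g := by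
  have hinv : (iota p)⁻¹ = iota p := inv_eq_of_mul_eq_one_left (iota_mul_self p)
  have hmul : ∀ a b : heckeGroup p, (∃ w, IsWord w ∧ w.prod = a) →
      (∃ w, IsWord w ∧ w.prod = b) → ∃ w, IsWord w ∧ w.prod = a * b := by
    rintro a b ⟨v, hv, rfl⟩ ⟨w, hw, rfl⟩
    refine ⟨v ++ w, fun s hs => ?_, by simp⟩
    rcases List.mem_append.1 hs with h | h
    exacts [hv s h, hw s h]
  have hone : ∀ s : heckeGroup p, s = iota p ∨ s = gamma p ∨ s = (gamma p)⁻¹ →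
      ∃ w, IsWord w ∧ w.prod = s := fun s hs => ⟨[s], by simpa [IsWord] using hs, by simp⟩
  have halpha : alpha p = iota p * gamma p := by
    rw [gamma, ← mul_assoc, iota_mul_self, one_mul]
  obtain ⟨g, hg⟩ := g
  refine Subgroup.closure_induction
    (p := fun g hg => ∃ w : List (heckeGroup p), IsWord w ∧ w.prod = ⟨g, hg⟩)
    ?_ ⟨[], by simp [IsWord], rfl⟩ (fun a b ha hb h1 h2 => hmul ⟨a, ha⟩ ⟨b, hb⟩ h1 h2) ?_ hg
  · rintro a (rfl | rfl)
    · exact hone (iota p) (by simp)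
    · change ∃ w, IsWord w ∧ w.prod = alpha p
      rw [halpha]
      exact hmul _ _ (hone _ (by simp)) (hone _ (by simp))
  · rintro a ha ⟨w, hw, h⟩
    refine ⟨(w.map (·⁻¹)).reverse, fun s hs => ?_, ?_⟩
    · obtain ⟨t, ht, rfl⟩ := List.mem_map.1 (List.mem_reverse.1 hs)
      rcases hw t ht with rfl | rfl | rfl <;> simp [hinv]
    · rw [← List.prod_inv_reverse, h]; rfl

end Hecke

/-! Ping-pong on the half-planes `re < 0` and `re > 0` shows that Γ_p is the free product of ⟨ι⟩ and
⟨γ⟩. Hence infinite-order classes correspond to nonempty cyclic words L = a₁…aₙ of nonzero residues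
mod p, read as γ^a₁ ι ⋯ γ^aₙ ι (`isConj_eval_iff`), and the class length is governed by `weight L`.
Inversion sends L to its negated reverse L*, so a reciprocal class is a rotation of T q T* r with q,
r empty or single letters.

Let N(w) be the number of words of weight at most w. A nonprimitive reciprocal class is a proper
power of such a word, so weight T is at most n/4 and there are at most C²(n+1)·N(n/4) of them, with
C constant (`ncard_nonprimitive_le`). Conversely T T* is reciprocal for every nonempty T, and a
class comes from at most n+1 words T, so about N(n/2)/(n+1) reciprocal classes exist
(`ncard_le_ncard_reciprocalClasses_mul`). Appending letters ±1 gives N(n/2) ≥ 2^(n/8)·N(n/4) for n ≥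
8 (`ncard_mul_two_pow_le`), so the nonprimitive proportion is O(n²/2^(n/8)). -/

namespace Hecke

/-! ### Powers of γ and their action on the two half-planes. -/

theorem inversionMatrix_mul_translationMatrix_pow (p : ℕ) (hp : 3 ≤ p) (k : ℕ) :
    (((inversionMatrix * translationMatrix p) ^ k : SL(2, ℝ)) : Matrix (Fin 2) (Fin 2) ℝ) =
      (Real.sin (Real.pi / p))⁻¹ •
        !![-Real.sin ((k - 1) * (Real.pi / p)), -Real.sin (k * (Real.pi / p));
          Real.sin (k * (Real.pi / p)), Real.sin ((k + 1) * (Real.pi / p))] := by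
  have hθ : Real.sin (Real.pi / p) ≠ 0 := by
    refine (Real.sin_pos_of_pos_of_lt_pi (by positivity) ?_).ne'
    have : (3 : ℝ) ≤ p := by exact_mod_cast hp
    rw [div_lt_iff₀ (by linarith)]
    nlinarith [Real.pi_pos]
  generalize hθ' : Real.pi / (p : ℝ) = θ at *
  have hM : ((inversionMatrix * translationMatrix p : SL(2, ℝ)) : Matrix (Fin 2) (Fin 2) ℝ) =
      !![0, -1; 1, 2 * Real.cos θ] := by
    rw [Matrix.SpecialLinearGroup.coe_mul]
    simp [inversionMatrix, translationMatrix, hθ']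
  induction k with
  | zero =>
    ext i j
    fin_cases i <;> fin_cases j <;> simp [hθ]
  | succ k ih =>
    have h1 : ((k : ℝ) + 1 + 1) * θ = (k + 1) * θ + θ := by ring
    have h2 : ((k : ℝ) * θ) = (k + 1) * θ - θ := by ring
    have h3 : ((k : ℝ) - 1) * θ = k * θ - θ := by ring
    have h4 : ((k : ℝ) + 1) * θ = k * θ + θ := by ring
    have e1 : Real.sin ((k + 1 + 1) * θ) =
        2 * Real.cos θ * Real.sin ((k + 1) * θ) - Real.sin (k * θ) := by
      rw [h1, h2, Real.sin_add, Real.sin_sub]; ring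
    have e2 : Real.sin ((k + 1) * θ) =
        2 * Real.cos θ * Real.sin (k * θ) - Real.sin ((k - 1) * θ) := by
      rw [h3, h4, Real.sin_add, Real.sin_sub]; ring
    rw [pow_succ, Matrix.SpecialLinearGroup.coe_mul, ih, hM]
    push_cast
    rw [e1, add_sub_cancel_right, e2]
    ext i j
    fin_cases i <;> fin_cases j <;> simp [Matrix.mul_apply, Fin.sum_univ_two] <;> ring

theorem coe_gamma_pow (p : ℕ) (hp : 3 ≤ p) (k : ℕ) (z : ℍ) :
    ((((gamma p ^ k : heckeGroup p) : Equiv.Perm ℍ) z : ℍ) : ℂ) =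
      (((-(Real.sin (Real.pi / p))⁻¹ * Real.sin ((k - 1) * (Real.pi / p)) : ℝ) : ℂ) * z +
        ((-(Real.sin (Real.pi / p))⁻¹ * Real.sin (k * (Real.pi / p)) : ℝ) : ℂ)) /
      ((((Real.sin (Real.pi / p))⁻¹ * Real.sin (k * (Real.pi / p)) : ℝ) : ℂ) * z +
        (((Real.sin (Real.pi / p))⁻¹ * Real.sin ((k + 1) * (Real.pi / p)) : ℝ) : ℂ)) := by
  have h : ((gamma p ^ k : heckeGroup p) : Equiv.Perm ℍ) =
      MulAction.toPermHom SL(2, ℝ) ℍ ((inversionMatrix * translationMatrix p) ^ k) := by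
    rw [map_pow, map_mul]; rfl
  have hM := inversionMatrix_mul_translationMatrix_pow p hp k
  generalize (inversionMatrix * translationMatrix p) ^ k = A at h hM
  rw [h, MulAction.toPermHom_apply, MulAction.toPerm_apply,
    UpperHalfPlane.coe_specialLinearGroup_apply]
  simp [hM]

theorem gamma_pow_self (p : ℕ) (hp : 3 ≤ p) : gamma p ^ p = 1 := by
  apply Subtype.ext
  apply Equiv.ext
  intro z
  apply UpperHalfPlane.ext
  have hp0 : (p : ℝ) ≠ 0 := by positivity
  have hθ : Real.sin (Real.pi / p) ≠ 0 := by
    refine (Real.sin_pos_of_pos_of_lt_pi (by positivity) ?_).ne'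
    have : (3 : ℝ) ≤ p := by exact_mod_cast hp
    rw [div_lt_iff₀ (by linarith)]
    nlinarith [Real.pi_pos]
  have h0 : (p : ℝ) * (Real.pi / p) = Real.pi := by field_simp
  have h1 : ((p : ℝ) - 1) * (Real.pi / p) = Real.pi - Real.pi / p := by rw [sub_mul, h0, one_mul]
  have h2 : ((p : ℝ) + 1) * (Real.pi / p) = Real.pi / p + Real.pi := by
    rw [add_mul, h0, one_mul, add_comm]
  rw [coe_gamma_pow p hp, h0, h1, h2, Real.sin_pi_sub, Real.sin_add_pi, Real.sin_pi]
  simp [hθ]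

/-- Ping-pong for γ: here γ^k z = -(az + b)/(bz + d) with a, d ≥ 0 and b > 0, since the sines
involved have arguments in [0, π]. So (az + b)·conj(bz + d) has positive real part when Re z > 0. -/
theorem re_gamma_pow_neg (p : ℕ) (hp : 3 ≤ p) (k : ℕ) (hk : 0 < k) (hkp : k < p) (z : ℍ)
    (hz : 0 < z.re) : (((gamma p ^ k : heckeGroup p) : Equiv.Perm ℍ) z).re < 0 := by
  have hp3 : (3 : ℝ) ≤ p := by exact_mod_cast hp
  have hp0 : (p : ℝ) ≠ 0 := by positivity
  have hθ0 : 0 < Real.pi / p := by positivity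
  have h0 : (p : ℝ) * (Real.pi / p) = Real.pi := by field_simp
  have hk1 : (1 : ℝ) ≤ k := by exact_mod_cast hk
  have hkp1 : (k : ℝ) + 1 ≤ p := by exact_mod_cast hkp
  have key := coe_gamma_pow p hp k z
  generalize ((gamma p ^ k : heckeGroup p) : Equiv.Perm ℍ) z = w at key
  have hs : 0 < (Real.sin (Real.pi / p))⁻¹ :=
    inv_pos.2 (Real.sin_pos_of_pos_of_lt_pi hθ0 (by nlinarith))
  have ha : 0 ≤ (Real.sin (Real.pi / p))⁻¹ * Real.sin ((k - 1) * (Real.pi / p)) :=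
    mul_nonneg hs.le (Real.sin_nonneg_of_nonneg_of_le_pi
      (mul_nonneg (by linarith) hθ0.le) (by nlinarith))
  have hb : 0 < (Real.sin (Real.pi / p))⁻¹ * Real.sin (k * (Real.pi / p)) :=
    mul_pos hs (Real.sin_pos_of_pos_of_lt_pi (by positivity) (by nlinarith))
  have hd : 0 ≤ (Real.sin (Real.pi / p))⁻¹ * Real.sin ((k + 1) * (Real.pi / p)) :=
    mul_nonneg hs.le (Real.sin_nonneg_of_nonneg_of_le_pi (by positivity) (by nlinarith))
  rw [neg_mul, neg_mul] at key
  generalize (Real.sin (Real.pi / p))⁻¹ * Real.sin ((k - 1) * (Real.pi / p)) = a at *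
  generalize (Real.sin (Real.pi / p))⁻¹ * Real.sin (k * (Real.pi / p)) = b at *
  generalize (Real.sin (Real.pi / p))⁻¹ * Real.sin ((k + 1) * (Real.pi / p)) = d at *
  have hre : w.re = ((w : ℍ) : ℂ).re := rfl
  have hz' : 0 < (z : ℂ).re := hz
  rw [hre, key, Complex.div_re, ← add_div]
  apply div_neg_of_neg_of_pos
  · simp only [Complex.add_re, Complex.mul_re, Complex.ofReal_re, Complex.ofReal_im,
      Complex.add_im, Complex.mul_im]
    generalize (z : ℂ).re = x at *
    generalize (z : ℂ).im = y at *
    have e1 : 0 ≤ a * b * (x * x + y * y) :=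
      mul_nonneg (mul_nonneg ha hb.le) (add_nonneg (mul_self_nonneg x) (mul_self_nonneg y))
    have e2 : 0 ≤ a * d * x := by positivity
    have e3 : 0 < b * b * x := by positivity
    have e4 : 0 ≤ b * d := by positivity
    nlinarith
  · apply Complex.normSq_pos.2
    intro h
    have := congrArg Complex.re h
    simp at this
    have e : 0 < b * (z : ℂ).re := by positivity
    simp only [UpperHalfPlane.coe_re] at e
    linarith

theorem re_inversion_pos (z : ℍ) (hz : z.re < 0) : 0 < (inversion z).re := by
  have hre : (inversion z).re = ((inversion z : ℍ) : ℂ).re := rfl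
  rw [hre, coe_inversion, neg_div, Complex.neg_re, one_div, Complex.inv_re, neg_pos]
  exact div_neg_of_neg_of_pos hz (Complex.normSq_pos.2 z.ne_zero)

end Hecke

/-! ### Alternating words and the free product structure. -/

namespace Hecke

/-- The exponents of `γ` that can occur inside a reduced word. -/
abbrev Letter (p : ℕ) := {a : ZMod p // a ≠ 0}

instance (p : ℕ) : InvolutiveNeg (Letter p) where
  neg a := ⟨-a.1, neg_ne_zero.2 a.2⟩
  neg_neg a := Subtype.ext (neg_neg a.1)

theorem Letter.coe_neg {p : ℕ} (a : Letter p) : ((-a : Letter p) : ZMod p) = -(a : ZMod p) := rfl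

/-- The power of `γ` with exponent in `ℤ / p`. -/
noncomputable def gammaPow {p : ℕ} (a : ZMod p) : heckeGroup p := gamma p ^ a.valMinAbs

/-- The product `γ ^ a₁ ι γ ^ a₂ ι ⋯ γ ^ aₙ ι`. -/
noncomputable def eval {p : ℕ} (L : List (Letter p)) : heckeGroup p :=
  (L.map fun a => gammaPow a.1 * iota p).prod

/-- The number of letters `ι`, `γ`, `γ⁻¹` in the word `γ ^ a₁ ι γ ^ a₂ ι ⋯ γ ^ aₙ ι`. -/
def weight {p : ℕ} (L : List (Letter p)) : ℕ :=
  (L.map fun a => a.1.valMinAbs.natAbs + 1).sum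

section eval

variable {p : ℕ}

@[simp] theorem eval_nil : eval ([] : List (Letter p)) = 1 := rfl

@[simp] theorem eval_cons (a : Letter p) (L : List (Letter p)) :
    eval (a :: L) = gammaPow a.1 * iota p * eval L := by simp [eval]

@[simp] theorem eval_append (L M : List (Letter p)) : eval (L ++ M) = eval L * eval M := by
  simp [eval]

theorem eval_replicate_flatten (k : ℕ) (L : List (Letter p)) :
    eval (List.replicate k L).flatten = eval L ^ k := by
  induction k with
  | zero => simp
  | succ k ih => rw [List.replicate_succ, List.flatten_cons, eval_append, ih, pow_succ']

@[simp] theorem weight_nil : weight ([] : List (Letter p)) = 0 := rfl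

@[simp] theorem weight_cons (a : Letter p) (L : List (Letter p)) :
    weight (a :: L) = a.1.valMinAbs.natAbs + 1 + weight L := by simp [weight]

@[simp] theorem weight_append (L M : List (Letter p)) :
    weight (L ++ M) = weight L + weight M := by
  simp [weight]

theorem weight_replicate_flatten (k : ℕ) (L : List (Letter p)) :
    weight (List.replicate k L).flatten = k * weight L := by
  induction k with
  | zero => simp
  | succ k ih => rw [List.replicate_succ, List.flatten_cons, weight_append, ih]; ring

theorem length_le_weight (L : List (Letter p)) : L.length ≤ weight L := by
  induction L with
  | nil => simp
  | cons a L ih => simp; omega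

theorem _root_.List.IsRotated.weight_eq {L M : List (Letter p)} (h : L ~r M) :
    weight L = weight M :=
  (h.perm.map _).sum_eq

theorem _root_.List.IsRotated.isConj_eval {L M : List (Letter p)} (h : L ~r M) :
    IsConj (eval L) (eval M) := by
  obtain ⟨n, hn, rfl⟩ := List.isRotated_iff_mod.1 h
  rw [List.rotate_eq_drop_append_take hn, isConj_iff]
  refine ⟨(eval (L.take n))⁻¹, ?_⟩
  have h : eval L = eval (L.take n) * eval (L.drop n) := by
    rw [← eval_append, List.take_append_drop]
  rw [h]
  simp

end eval

theorem iota_inv (p : ℕ) : (iota p)⁻¹ = iota p := inv_eq_of_mul_eq_one_left (iota_mul_self p)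

theorem iota_mul_cancel {p : ℕ} (g : heckeGroup p) : iota p * (iota p * g) = g := by
  rw [← mul_assoc, iota_mul_self, one_mul]

@[simp] theorem gammaPow_zero {p : ℕ} : gammaPow (0 : ZMod p) = 1 := by simp [gammaPow]

variable {p : ℕ} [hp : Fact (3 ≤ p)]

instance : NeZero p := ⟨by have := hp.out; omega⟩

instance : Fact (1 < p) := ⟨by have := hp.out; omega⟩

theorem gammaPow_intCast (k : ℤ) : gammaPow (k : ZMod p) = gamma p ^ k := by
  have h : ((((k : ZMod p).valMinAbs - k : ℤ)) : ZMod p) = 0 := by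
    simp
  obtain ⟨m, hm⟩ := (ZMod.intCast_zmod_eq_zero_iff_dvd _ p).1 h
  rw [gammaPow, ← sub_add_cancel (k : ZMod p).valMinAbs k, hm, zpow_add, zpow_mul,
    zpow_natCast, gamma_pow_self p hp.out, one_zpow, one_mul]

theorem gammaPow_add (a b : ZMod p) : gammaPow (a + b) = gammaPow a * gammaPow b := by
  rw [← ZMod.coe_valMinAbs a, ← ZMod.coe_valMinAbs b, ← Int.cast_add, gammaPow_intCast,
    gammaPow_intCast, gammaPow_intCast, zpow_add]

theorem gammaPow_neg (a : ZMod p) : gammaPow (-a) = (gammaPow a)⁻¹ := by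
  rw [eq_inv_iff_mul_eq_one, ← gammaPow_add, neg_add_cancel, gammaPow_zero]

theorem gammaPow_pow_self (a : ZMod p) : gammaPow a ^ p = 1 := by
  rw [gammaPow, ← zpow_natCast, zpow_comm, zpow_natCast, gamma_pow_self p hp.out, one_zpow]

theorem eval_inv (L : List (Letter p)) :
    (eval L)⁻¹ = iota p * eval (L.map Neg.neg).reverse * iota p := by
  induction L with
  | nil => simp [iota_mul_self]
  | cons a L ih =>
    rw [eval_cons, mul_inv_rev, ih, mul_inv_rev, iota_inv, ← gammaPow_neg]
    simp [mul_assoc, Letter.coe_neg, iota_mul_cancel, iota_mul_self]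

theorem re_gammaPow_neg (a : ZMod p) (ha : a ≠ 0) (z : ℍ) (hz : 0 < z.re) :
    ((gammaPow a : Equiv.Perm ℍ) z).re < 0 := by
  have h : gammaPow a = gamma p ^ a.val := by
    rw [← zpow_natCast, ← gammaPow_intCast, Int.cast_natCast, ZMod.natCast_zmod_val]
  rw [h]
  exact re_gamma_pow_neg p hp.out _ (Nat.pos_of_ne_zero (by rwa [Ne, ZMod.val_eq_zero]))
    (ZMod.val_lt a) z hz

theorem re_eval_neg (L : List (Letter p)) (z : ℍ) (hz : z.re < 0) :
    ((eval L : Equiv.Perm ℍ) z).re < 0 := by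
  induction L with
  | nil => simpa
  | cons a L ih =>
    rw [eval_cons]
    exact re_gammaPow_neg a.1 a.2 _ (re_inversion_pos _ ih)

/-- Alternating words ending in ι preserve the left half-plane; a further ι on the left moves it to
the right one. -/
theorem iota_mul_eval_ne_eval (K L : List (Letter p)) : iota p * eval K ≠ eval L := by
  intro h
  let z : ℍ := ⟨⟨-1, 1⟩, by simp⟩
  have hz : z.re < 0 := by
    change (-1 : ℝ) < 0
    norm_num
  have h1 := re_eval_neg L z hz
  rw [← h] at h1
  exact lt_asymm h1 (re_inversion_pos _ (re_eval_neg K z hz))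

theorem one_ne_neg_one : (1 : ZMod p) ≠ -1 :=
  haveI : Fact (2 < p) := hp
  ZMod.neg_one_ne_one.symm

theorem exists_letter_ne (a : Letter p) : ∃ c : Letter p, c ≠ a := by
  by_cases ha : a = ⟨1, one_ne_zero⟩
  · refine ⟨⟨-1, neg_ne_zero.2 one_ne_zero⟩, fun h => one_ne_neg_one (p := p) ?_⟩
    exact (congrArg Subtype.val (h.trans ha)).symm
  · exact ⟨⟨1, one_ne_zero⟩, Ne.symm ha⟩

theorem eval_ne_one {L : List (Letter p)} (hL : L ≠ []) : eval L ≠ 1 := by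
  intro h
  obtain ⟨a, K, rfl⟩ := List.exists_cons_of_ne_nil hL
  obtain ⟨c, hc⟩ := exists_letter_ne a
  have hca : -a.1 + c.1 ≠ 0 := fun h => hc (Subtype.ext (neg_add_eq_zero.1 h).symm)
  -- From ι · eval K = γ^(-a), right multiplication by γ^c ι gives an equality excluded by
  -- ping-pong; c ≠ a keeps the exponent c - a nonzero.
  apply iota_mul_eval_ne_eval (K ++ [c]) [⟨-a.1 + c.1, hca⟩]
  rw [eval_cons, mul_assoc, mul_eq_one_iff_inv_eq, ← gammaPow_neg] at h
  simp only [eval_append, eval_cons, eval_nil, gammaPow_add, h, mul_assoc, mul_one]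

theorem eval_injective : Function.Injective (eval : List (Letter p) → heckeGroup p) := by
  intro L
  induction L with
  | nil =>
    intro M h
    by_contra hM
    exact eval_ne_one (Ne.symm hM) h.symm
  | cons a L ih =>
    intro M h
    cases M with
    | nil => exact absurd h (eval_ne_one (by simp))
    | cons b M =>
      rw [eval_cons, eval_cons] at h
      by_cases hab : a = b
      · subst hab
        rw [ih (mul_left_cancel h)]
      -- Distinct first letters would give ι · eval L = γ^(b-a) ι · eval M.
      · have hba : b.1 - a.1 ≠ 0 := sub_ne_zero.2 fun h => hab (Subtype.ext h.symm)
        refine absurd ?_ (iota_mul_eval_ne_eval L (⟨b.1 - a.1, hba⟩ :: M))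
        rw [mul_assoc, ← eq_inv_mul_iff_mul_eq, ← gammaPow_neg] at h
        rw [eval_cons]
        change _ = gammaPow (b.1 - a.1) * iota p * eval M
        rw [h, sub_eq_add_neg, add_comm, gammaPow_add]
        simp only [mul_assoc]

/-! ### Conjugacy of alternating words. -/

theorem not_isOfFinOrder_eval {L : List (Letter p)} (hL : L ≠ []) : ¬ IsOfFinOrder (eval L) := by
  rw [isOfFinOrder_iff_pow_eq_one]
  rintro ⟨n, hn, h⟩
  rw [← eval_replicate_flatten] at h
  refine eval_ne_one ?_ h
  simp [hL, hn.ne']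

/-- A conjugator h of `eval L` may be replaced by h · (eval L)^n. Such a power absorbs the trailing
γ^b of h, leaving only words that end in ι, up to an initial ι. -/
theorem exists_mul_eval_pow_eq {L : List (Letter p)} (hL : L ≠ []) (h : heckeGroup p) :
    ∃ (n : ℕ) (K : List (Letter p)), h * eval L ^ n = eval K ∨ h * eval L ^ n = iota p * eval K := by
  have hγ : ∀ (a : ZMod p) (h : heckeGroup p),
      (∃ (n : ℕ) (K : List (Letter p)),
        h * eval L ^ n = eval K ∨ h * eval L ^ n = iota p * eval K) →
      ∃ (n : ℕ) (K : List (Letter p)), gammaPow a * h * eval L ^ n = eval K ∨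
        gammaPow a * h * eval L ^ n = iota p * eval K := by
    rintro a h ⟨n, K, hK | hK⟩
    -- K may be empty; one more factor `eval L` supplies a first letter for γ^a to merge with.
    · have hne : K ++ L ≠ [] := by simp [hL]
      have hK' : h * eval L ^ (n + 1) = eval (K ++ L) := by
        rw [pow_succ, ← mul_assoc, hK, eval_append]
      obtain ⟨b, K', hb⟩ := List.exists_cons_of_ne_nil hne
      refine ⟨n + 1, ?_⟩
      rw [mul_assoc, hK', hb, eval_cons, mul_assoc, ← mul_assoc, ← gammaPow_add]
      by_cases hab : a + b.1 = 0
      · exact ⟨K', Or.inr (by rw [hab, gammaPow_zero, one_mul])⟩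
      · exact ⟨⟨_, hab⟩ :: K', Or.inl (by rw [eval_cons, mul_assoc])⟩
    · by_cases ha : a = 0
      · exact ⟨n, K, Or.inr (by rw [ha, gammaPow_zero, one_mul, hK])⟩
      · exact ⟨n, ⟨a, ha⟩ :: K, Or.inl (by rw [mul_assoc, hK, eval_cons, mul_assoc])⟩
  obtain ⟨w, hw, rfl⟩ := exists_isWord h
  induction w with
  | nil => exact ⟨0, [], Or.inl (by simp)⟩
  | cons s w ih =>
    have ih := ih fun t ht => hw t (List.mem_cons_of_mem _ ht)
    rw [List.prod_cons]
    rcases hw s List.mem_cons_self with rfl | rfl | rfl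
    · obtain ⟨n, K, hK | hK⟩ := ih
      · exact ⟨n, K, Or.inr (by rw [mul_assoc, hK])⟩
      · exact ⟨n, K, Or.inl (by rw [mul_assoc, hK, iota_mul_cancel])⟩
    · have := hγ ((1 : ℤ) : ZMod p) _ ih
      rwa [gammaPow_intCast, zpow_one] at this
    · have := hγ ((-1 : ℤ) : ZMod p) _ ih
      rwa [gammaPow_intCast, zpow_neg_one] at this

theorem _root_.List.isRotated_of_append_eq_append {α : Type*} {L M K : List α}
    (h : M ++ K = K ++ L) : L ~r M := by
  induction hn : K.length using Nat.strong_induction_on generalizing K with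
  | _ n ih =>
    rcases List.append_eq_append_iff.1 h with ⟨X, rfl, hX⟩ | ⟨Y, rfl, rfl⟩
    · by_cases hM : M = []
      · subst hM
        have : L = [] := by simpa using congrArg List.length h
        rw [this]
      · refine ih X.length ?_ hX rfl
        have := List.length_pos_iff.2 hM
        simp at hn
        omega
    · exact List.isRotated_append

/-- With the conjugator normalised to `eval K`, injectivity of `eval` gives MK = KL as words, hence
a rotation. A conjugator ι · eval K would give K = M* K L, impossible by length. -/
theorem isConj_eval_iff {L M : List (Letter p)} (hL : L ≠ []) :
    IsConj (eval L) (eval M) ↔ L ~r M := by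
  refine ⟨fun h => ?_, List.IsRotated.isConj_eval⟩
  obtain ⟨h, hh⟩ := isConj_iff.1 h
  obtain ⟨n, K, hK | hK⟩ := exists_mul_eval_pow_eq hL h
  · refine List.isRotated_of_append_eq_append (K := K) (eval_injective ?_)
    rw [eval_append, eval_append, ← hK, ← hh]
    simp only [mul_assoc, inv_mul_cancel_left, ← pow_succ, ← pow_succ']
  · exfalso
    have h1 : eval M * (h * eval L ^ n) = h * eval L ^ n * eval L := by
      rw [← hh]
      simp only [mul_assoc, inv_mul_cancel_left, ← pow_succ, ← pow_succ']
    rw [hK] at h1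
    have h2 : iota p * eval K = iota p * eval ((M.map Neg.neg).reverse ++ (K ++ L)) := by
      refine (eq_inv_mul_iff_mul_eq.2 h1).trans ?_
      rw [eval_inv]
      simp only [eval_append, mul_assoc, iota_mul_cancel]
    have h3 := congrArg List.length (eval_injective (mul_left_cancel h2))
    have := List.length_pos_iff.2 hL
    simp at h3
    omega

theorem isConj_inv_eval (L : List (Letter p)) :
    IsConj (eval L)⁻¹ (eval (L.map Neg.neg).reverse) := by
  rw [isConj_iff]
  refine ⟨iota p, ?_⟩
  rw [eval_inv, iota_inv]
  simp only [mul_assoc, iota_mul_cancel, iota_mul_self, mul_one]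

end Hecke

/-! ### Combinatorics of symmetric words and of powers of words. -/

theorem List.exists_eq_append_of_eq_neg_reverse {α : Type*} [InvolutiveNeg α] (L : List α)
    (h : (L.map Neg.neg).reverse = L) :
    ∃ (T : List α) (q : Option α), L = T ++ q.toList ++ (T.map Neg.neg).reverse := by
  induction L using List.bidirectionalRec with
  | nil => exact ⟨[], none, by simp⟩
  | singleton a => exact ⟨[], some a, by simp⟩
  | cons_append a L b ih =>
    simp only [List.map_cons, List.map_append, List.map_nil, List.reverse_cons,
      List.reverse_append, List.reverse_nil, List.nil_append, List.cons_append,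
      List.cons.injEq] at h
    obtain ⟨h1, h2⟩ := h
    obtain ⟨h3, h4⟩ := List.append_inj' h2 rfl
    obtain ⟨T, q, hT⟩ := ih h3
    refine ⟨a :: T, q, ?_⟩
    have h5 : b = -a := by simpa using h4.symm
    rw [h5, List.map_cons, List.reverse_cons, List.cons_append, List.cons_append,
      ← List.append_assoc, ← hT]

/-- If L = XY and YX = (XY)* = Y* X*, then X = X* and Y = Y*. Writing X = T q T* and Y = S r S*, the
word XY rotates to (S* T) q (S* T)* r. -/
theorem List.exists_isRotated_of_isRotated_neg_reverse {α : Type*} [InvolutiveNeg α] {L : List α}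
    (h : L ~r (L.map Neg.neg).reverse) :
    ∃ (T : List α) (q r : Option α),
      L ~r T ++ q.toList ++ (T.map Neg.neg).reverse ++ r.toList := by
  obtain ⟨n, hn, h⟩ := List.isRotated_iff_mod.1 h
  rw [List.rotate_eq_drop_append_take hn] at h
  have hL := List.take_append_drop n L
  generalize L.take n = X at *
  generalize L.drop n = Y at *
  subst hL
  rw [List.map_append, List.reverse_append] at h
  obtain ⟨hY, hX⟩ := List.append_inj h (by simp)
  obtain ⟨T, q, hT⟩ := List.exists_eq_append_of_eq_neg_reverse X hX.symm
  obtain ⟨S, r, hS⟩ := List.exists_eq_append_of_eq_neg_reverse Y hY.symm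
  refine ⟨(S.map Neg.neg).reverse ++ T, q, r, ?_⟩
  have h1 : X ++ Y = (T ++ q.toList ++ (T.map Neg.neg).reverse ++ S ++ r.toList) ++
      (S.map Neg.neg).reverse := by
    rw [hT, hS]
    simp
  rw [h1]
  refine List.isRotated_append.trans ?_
  simp only [List.map_append, List.reverse_append, List.map_reverse, List.reverse_reverse,
    List.map_map, neg_comp_neg, List.map_id, List.append_assoc]
  exact List.IsRotated.refl _

theorem List.flatten_replicate_append_comm {α : Type*} (X Y : List α) (k : ℕ) :
    (List.replicate k (X ++ Y)).flatten ++ X = X ++ (List.replicate k (Y ++ X)).flatten := by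
  induction k with
  | zero => simp
  | succ k ih => simp [List.replicate_succ, ih]

theorem List.rotate_flatten_replicate {α : Type*} (M : List α) (k n : ℕ) :
    (List.replicate k M).flatten.rotate n = (List.replicate k (M.rotate n)).flatten := by
  induction n generalizing M with
  | zero => simp
  | succ n ih =>
    have h1 : (List.replicate k M).flatten.rotate 1 = (List.replicate k (M.rotate 1)).flatten := by
      cases k with
      | zero => simp
      | succ k =>
        cases M with
        | nil => simp
        | cons a M =>
          have := List.flatten_replicate_append_comm [a] M k
          simp only [List.singleton_append] at this
          simp [List.replicate_succ, this]
    rw [add_comm, ← List.rotate_rotate, h1, ih, List.rotate_rotate]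

/-- Rotating a power rotates its base, so comparing the first blocks suffices. -/
theorem List.isRotated_of_flatten_replicate {α : Type*} {M N : List α} {k : ℕ} (hk : k ≠ 0)
    (hMN : M.length = N.length)
    (h : (List.replicate k M).flatten ~r (List.replicate k N).flatten) : M ~r N := by
  obtain ⟨n, h⟩ := h
  refine ⟨n, ?_⟩
  obtain ⟨k, rfl⟩ := Nat.exists_eq_succ_of_ne_zero hk
  rw [List.rotate_flatten_replicate, List.replicate_succ, List.replicate_succ, List.flatten_cons,
    List.flatten_cons] at h
  exact (List.append_inj h (by simpa)).1

/-! ### Word length and cyclic reduction. -/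

namespace Hecke

variable {p : ℕ}

theorem natAbs_valMinAbs_add_le (a b : ZMod p) :
    (a + b).valMinAbs.natAbs ≤ a.valMinAbs.natAbs + b.valMinAbs.natAbs :=
  (ZMod.natAbs_valMinAbs_add_le a b).trans (Int.natAbs_add_le _ _)

/-- `g` is equal to `γ ^ a₁ ι ⋯ γ ^ aₘ ι γ ^ b`, up to an initial `ι`, and this word has at most `n`
letters. -/
def HasNormalForm (g : heckeGroup p) (n : ℕ) : Prop :=
  ∃ (K : List (Letter p)) (b : ZMod p),
    (g = eval K * gammaPow b ∧ weight K + b.valMinAbs.natAbs ≤ n) ∨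
    (g = iota p * eval K * gammaPow b ∧ weight K + b.valMinAbs.natAbs + 1 ≤ n)

theorem HasNormalForm.iota_mul {g : heckeGroup p} {n : ℕ} (h : HasNormalForm g n) :
    HasNormalForm (iota p * g) (n + 1) := by
  obtain ⟨K, b, ⟨rfl, h⟩ | ⟨rfl, h⟩⟩ := h
  · exact ⟨K, b, Or.inr ⟨by rw [mul_assoc], by omega⟩⟩
  · exact ⟨K, b, Or.inl ⟨by rw [mul_assoc, iota_mul_cancel], by omega⟩⟩

/-- `g` is conjugate to an alternating word with at most `n` letters, unless it has finite order. -/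
def HasCyclicForm (g : heckeGroup p) (n : ℕ) : Prop :=
  IsOfFinOrder g ∨ ∃ L : List (Letter p), IsConj g (eval L) ∧ weight L ≤ n

theorem HasCyclicForm.of_isConj {g h : heckeGroup p} {m n : ℕ} (hg : HasCyclicForm g m)
    (hgh : IsConj g h) (hmn : m ≤ n) : HasCyclicForm h n := by
  obtain hg | ⟨L, hL, hw⟩ := hg
  · exact Or.inl (hgh.isOfFinOrder hg)
  · exact Or.inr ⟨L, hgh.symm.trans hL, hw.trans hmn⟩

theorem isConj_mul_comm {G : Type*} [Group G] (a b : G) : IsConj (a * b) (b * a) :=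
  isConj_iff.2 ⟨b, by group⟩

theorem exists_isWord_gammaPow (a : ZMod p) :
    ∃ w : List (heckeGroup p), IsWord w ∧ w.prod = gammaPow a ∧
      w.length = a.valMinAbs.natAbs := by
  rw [gammaPow]
  obtain ⟨n, h | h⟩ := Int.eq_nat_or_neg a.valMinAbs
  · refine ⟨List.replicate n (gamma p), fun s hs => ?_, by simp [h], by simp [h]⟩
    exact Or.inr (Or.inl (List.eq_of_mem_replicate hs))
  · refine ⟨List.replicate n (gamma p)⁻¹, fun s hs => ?_, by simp [h], by simp [h]⟩
    exact Or.inr (Or.inr (List.eq_of_mem_replicate hs))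

theorem exists_isWord_eval (L : List (Letter p)) :
    ∃ w : List (heckeGroup p), IsWord w ∧ w.prod = eval L ∧ w.length = weight L := by
  induction L with
  | nil => exact ⟨[], by simp [IsWord], rfl, rfl⟩
  | cons a L ih =>
    obtain ⟨v, hv, hv1, hv2⟩ := ih
    obtain ⟨u, hu, hu1, hu2⟩ := exists_isWord_gammaPow a.1
    refine ⟨u ++ iota p :: v, fun s hs => ?_, by simp [hu1, hv1, mul_assoc], ?_⟩
    · rcases List.mem_append.1 hs with hs | hs
      · exact hu s hs
      · rcases List.mem_cons.1 hs with rfl | hs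
        · exact Or.inl rfl
        · exact hv s hs
    · simp [hu2, hv2]
      ring

theorem classLength_mk_eval_le (L : List (Letter p)) :
    classLength (ConjClasses.mk (eval L)) ≤ weight L := by
  obtain ⟨w, hw, h1, h2⟩ := exists_isWord_eval L
  have h : wordLength (eval L) ≤ weight L := Nat.sInf_le ⟨w, hw, h1, h2⟩
  exact (Nat.sInf_le (Set.mem_image_of_mem wordLength ConjClasses.mem_carrier_mk)).trans h

theorem weight_map_neg_reverse (T : List (Letter p)) :
    weight (T.map Neg.neg).reverse = weight T := by
  simp [weight, List.sum_reverse, Function.comp_def, Letter.coe_neg, ZMod.natAbs_valMinAbs_neg]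

variable [hp : Fact (3 ≤ p)]

theorem natAbs_valMinAbs_one : ((1 : ZMod p).valMinAbs).natAbs = 1 := by
  have := ZMod.valMinAbs_natCast_of_le_half (n := p) (a := 1) (by have := hp.out; omega)
  rw [Nat.cast_one] at this
  rw [this]
  rfl

theorem HasNormalForm.gammaPow_mul {g : heckeGroup p} {n : ℕ} (h : HasNormalForm g n) (s : ZMod p)
    (hs : s.valMinAbs.natAbs = 1) : HasNormalForm (gammaPow s * g) (n + 1) := by
  obtain ⟨K, b, ⟨rfl, h⟩ | ⟨rfl, h⟩⟩ := h
  · cases K with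
    | nil =>
      refine ⟨[], s + b, Or.inl ⟨by simp [gammaPow_add], ?_⟩⟩
      have := natAbs_valMinAbs_add_le s b
      simp at h ⊢
      omega
    | cons a K =>
      rw [weight_cons] at h
      rw [eval_cons]
      by_cases ha : s + a.1 = 0
      · refine ⟨K, b, Or.inr ⟨?_, by omega⟩⟩
        simp only [← mul_assoc, ← gammaPow_add, ha, gammaPow_zero, one_mul]
      · refine ⟨⟨s + a.1, ha⟩ :: K, b, Or.inl ⟨?_, ?_⟩⟩
        · simp only [eval_cons, ← mul_assoc, ← gammaPow_add]
        · have := natAbs_valMinAbs_add_le s a.1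
          rw [weight_cons]
          dsimp only
          omega
  · have hs0 : s ≠ 0 := by
      rintro rfl
      simp at hs
    refine ⟨⟨s, hs0⟩ :: K, b, Or.inl ⟨by simp only [eval_cons, ← mul_assoc], ?_⟩⟩
    rw [weight_cons]
    dsimp only
    omega

theorem IsWord.hasNormalForm {w : List (heckeGroup p)} (hw : IsWord w) :
    HasNormalForm w.prod w.length := by
  induction w with
  | nil => exact ⟨[], 0, Or.inl (by simp)⟩
  | cons s w ih =>
    have ih := ih fun t ht => hw t (List.mem_cons_of_mem _ ht)
    rw [List.prod_cons, List.length_cons]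
    rcases hw s List.mem_cons_self with rfl | rfl | rfl
    · exact ih.iota_mul
    · have := ih.gammaPow_mul ((1 : ℤ) : ZMod p) (by rw [Int.cast_one, natAbs_valMinAbs_one])
      rwa [gammaPow_intCast, zpow_one] at this
    · have := ih.gammaPow_mul ((-1 : ℤ) : ZMod p)
        (by rw [Int.cast_neg, Int.cast_one, ZMod.natAbs_valMinAbs_neg, natAbs_valMinAbs_one])
      rwa [gammaPow_intCast, zpow_neg_one] at this

/-- Cyclic reduction by a joint induction: γ^b merges into the first letter of K, which yields the
second form with a shorter K; if the exponent there is 0, the leading ι is conjugated to the end and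
cancels, which yields the first form again. Reduction to γ^b or ι alone means finite order. -/
theorem hasCyclicForm_gammaPow_mul_eval (K : List (Letter p)) (b : ZMod p) :
    HasCyclicForm (gammaPow b * eval K) (weight K + b.valMinAbs.natAbs) ∧
      HasCyclicForm (gammaPow b * (iota p * eval K)) (weight K + b.valMinAbs.natAbs + 1) := by
  induction hn : K.length using Nat.strong_induction_on generalizing K b with
  | _ n ih =>
    constructor
    · cases K with
      | nil =>
        left
        rw [eval_nil, mul_one]
        exact isOfFinOrder_iff_pow_eq_one.2
          ⟨p, by have := hp.out; omega, gammaPow_pow_self b⟩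
      | cons a K =>
        refine (ih K.length (by simp at hn; omega) K (b + a.1) rfl).2.of_isConj ?_ ?_
        · rw [gammaPow_add, eval_cons]
          simp only [mul_assoc]
          exact IsConj.refl _
        · have := natAbs_valMinAbs_add_le b a.1
          rw [weight_cons]
          omega
    · by_cases hb : b = 0
      · subst hb
        rw [gammaPow_zero, one_mul]
        rcases List.eq_nil_or_concat K with rfl | ⟨K', a, rfl⟩
        · left
          rw [eval_nil, mul_one]
          exact isOfFinOrder_iff_pow_eq_one.2 ⟨2, by norm_num, by rw [sq, iota_mul_self]⟩
        · refine (ih K'.length (by simp at hn; omega) K' a.1 rfl).1.of_isConj ?_ ?_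
          · have h := isConj_mul_comm (iota p) (eval (K'.concat a))
            refine ((isConj_mul_comm _ _).trans ?_).trans h.symm
            rw [List.concat_eq_append]
            simp only [eval_append, eval_cons, eval_nil, mul_assoc, iota_mul_self, mul_one]
            exact IsConj.refl _
          · rw [List.concat_eq_append]
            simp
            omega
      · refine Or.inr ⟨⟨b, hb⟩ :: K, ?_, ?_⟩
        · rw [eval_cons, mul_assoc]
        · rw [weight_cons]
          dsimp only
          omega

theorem HasNormalForm.hasCyclicForm {g : heckeGroup p} {n : ℕ} (h : HasNormalForm g n) :
    HasCyclicForm g n := by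
  obtain ⟨K, b, ⟨rfl, h⟩ | ⟨rfl, h⟩⟩ := h
  · exact (hasCyclicForm_gammaPow_mul_eval K b).1.of_isConj (isConj_mul_comm _ _) h
  · exact (hasCyclicForm_gammaPow_mul_eval K b).2.of_isConj (isConj_mul_comm _ _) h

theorem exists_eval_eq_of_not_isOfFinOrder {g : heckeGroup p} (hg : ¬ IsOfFinOrder g) :
    ∃ L : List (Letter p), L ≠ [] ∧ IsConj g (eval L) ∧
      weight L ≤ classLength (ConjClasses.mk g) := by
  have hne : (wordLength '' (ConjClasses.mk g).carrier).Nonempty :=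
    ⟨_, g, ConjClasses.mem_carrier_mk, rfl⟩
  obtain ⟨g', hg', hlen⟩ := Nat.sInf_mem hne
  have hword : {n : ℕ | ∃ w : List (heckeGroup p), IsWord w ∧ w.prod = g' ∧ w.length = n}.Nonempty := by
    obtain ⟨w, hw, h⟩ := exists_isWord g'
    exact ⟨_, w, hw, h, rfl⟩
  obtain ⟨w, hw, rfl, hwl⟩ := Nat.sInf_mem hword
  have hconj : IsConj g w.prod :=
    (ConjClasses.mk_eq_mk_iff_isConj.1 (ConjClasses.mem_carrier_iff_mk_eq.1 hg')).symm
  have hle : w.length ≤ classLength (ConjClasses.mk g) := by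
    rw [classLength, ← hlen, wordLength, hwl]
  obtain h | ⟨L, hL, hwt⟩ := (hw.hasNormalForm.hasCyclicForm.of_isConj hconj.symm hle)
  · exact absurd h hg
  · refine ⟨L, ?_, hL, hwt⟩
    rintro rfl
    exact hg (hL.symm.isOfFinOrder (by simp))

/-! ### Reciprocal elements and proper powers. -/

theorem exists_isConj_eval_pow {b : heckeGroup p} (hb : ¬ IsOfFinOrder b) {k : ℤ} (hk0 : k ≠ 0) :
    ∃ M : List (Letter p), M ≠ [] ∧
      IsConj (b ^ k) (eval (List.replicate k.natAbs M).flatten) := by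
  have main : ∀ b : heckeGroup p, ¬ IsOfFinOrder b → ∀ n : ℕ, ∃ M : List (Letter p), M ≠ [] ∧
      IsConj (b ^ n) (eval (List.replicate n M).flatten) := by
    intro b hb n
    obtain ⟨M, hM, hc, -⟩ := exists_eval_eq_of_not_isOfFinOrder hb
    exact ⟨M, hM, by rw [eval_replicate_flatten]; exact hc.pow n⟩
  obtain ⟨n, rfl | rfl⟩ := Int.eq_nat_or_neg k
  · simpa using main b hb n
  · simpa using main b⁻¹ (by simpa) n

theorem IsReciprocal.isRotated {g : heckeGroup p} (hg : IsReciprocal g) {L : List (Letter p)}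
    (hL : L ≠ []) (hgL : IsConj g (eval L)) : L ~r (L.map Neg.neg).reverse := by
  obtain ⟨h, hh⟩ := hg.2
  rw [← isConj_eval_iff hL]
  have hinv : IsConj g⁻¹ (eval L)⁻¹ := by
    obtain ⟨c, hc⟩ := isConj_iff.1 hgL
    exact isConj_iff.2 ⟨c, by rw [← hc]; group⟩
  exact (hgL.symm.trans (isConj_iff.2 ⟨h, hh⟩)).trans (hinv.trans (isConj_inv_eval L))

theorem isReciprocal_eval {L : List (Letter p)} (hL : L ≠ []) (h : (L.map Neg.neg).reverse = L) :
    IsReciprocal (eval L) := by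
  refine ⟨not_isOfFinOrder_eval hL, ?_⟩
  obtain ⟨c, hc⟩ := isConj_iff.1 (isConj_inv_eval L).symm
  rw [h] at hc
  exact ⟨c, hc⟩

/-- A reciprocal element that is not primitive is conjugate to a proper power of a product of two
conjugates of involutions. -/
theorem IsReciprocal.exists_isConj_of_not_isPrimitive {g : heckeGroup p} (hg : IsReciprocal g)
    (hprim : ¬ IsPrimitive g) :
    ∃ (T : List (Letter p)) (q r : Option (Letter p)) (k : ℕ),
      IsConj g (eval (T ++ q.toList ++ (T.map Neg.neg).reverse ++ r.toList) ^ k) ∧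
      k ≤ classLength (ConjClasses.mk g) ∧ 4 * weight T ≤ classLength (ConjClasses.mk g) := by
  obtain ⟨L, hL, hgL, hw⟩ := exists_eval_eq_of_not_isOfFinOrder hg.1
  simp only [IsPrimitive] at hprim
  push Not at hprim
  obtain ⟨b, k, rfl, hk1, hk2⟩ := hprim
  have hk0 : k ≠ 0 := by
    rintro rfl
    exact hg.1 (by simp)
  obtain ⟨M, hM, hbM⟩ := exists_isConj_eval_pow (fun h => hg.1 (h.zpow)) hk0 (b := b)
  have hk : 2 ≤ k.natAbs := by omega
  generalize k.natAbs = m at *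
  have hLM : L ~r (List.replicate m M).flatten := (isConj_eval_iff hL).1 (hgL.symm.trans hbM)
  have hne : (List.replicate m M).flatten ≠ [] := by
    have : m ≠ 0 := by omega
    simp [hM, this]
  have hrot := hg.isRotated hne hbM
  have hrev : ((List.replicate m M).flatten.map Neg.neg).reverse =
      (List.replicate m (M.map Neg.neg).reverse).flatten := by
    simp [List.map_flatten, List.reverse_flatten]
  rw [hrev] at hrot
  -- The symmetry M^m ~ (M*)^m descends to M ~ M*: the root is reciprocal too.
  obtain ⟨T, q, r, hT⟩ := List.exists_isRotated_of_isRotated_neg_reverse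
    (List.isRotated_of_flatten_replicate (by omega) (by simp) hrot)
  have hwM : m * weight M ≤ classLength (ConjClasses.mk (b ^ k)) := by
    rwa [← weight_replicate_flatten, ← hLM.weight_eq]
  have hM1 : 1 ≤ weight M := (List.length_pos_iff.2 hM).trans_le (length_le_weight M)
  have hTM : 2 * weight T ≤ weight M := by
    rw [hT.weight_eq]
    simp only [weight_append, weight_map_neg_reverse]
    omega
  -- As m ≥ 2, 4 · weight T ≤ 2 · weight M ≤ m · weight M; as weight M ≥ 1, also m ≤ m · weight M.
  refine ⟨T, q, r, m, ?_, by nlinarith, by nlinarith⟩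
  refine hbM.trans ?_
  rw [eval_replicate_flatten]
  exact hT.isConj_eval.pow m

end Hecke

/-! ### Counting reciprocal and nonprimitive classes. -/

namespace Hecke

variable {p : ℕ}

theorem primitiveReciprocalClasses_subset (x : ℝ) :
    primitiveReciprocalClasses p x ⊆ reciprocalClasses p x :=
  fun _ ⟨⟨g, hgc, hg⟩, hc⟩ => ⟨⟨g, hgc, hg.1⟩, hc⟩

theorem reciprocalClasses_natFloor {x : ℝ} (hx : 0 ≤ x) :
    reciprocalClasses p x = reciprocalClasses p (⌊x⌋₊ : ℝ) := by
  ext c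
  simp only [reciprocalClasses, Set.mem_ofPred_eq, Nat.cast_le, Nat.le_floor_iff hx]

theorem primitiveReciprocalClasses_natFloor {x : ℝ} (hx : 0 ≤ x) :
    primitiveReciprocalClasses p x = primitiveReciprocalClasses p (⌊x⌋₊ : ℝ) := by
  ext c
  simp only [primitiveReciprocalClasses, Set.mem_ofPred_eq, Nat.cast_le, Nat.le_floor_iff hx]

variable [hp : Fact (3 ≤ p)]

theorem finite_weight_le (n : ℕ) : {L : List (Letter p) | weight L ≤ n}.Finite :=
  (List.finite_length_le (Letter p) n).subset fun L hL => (length_le_weight L).trans hL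

theorem finite_reciprocalClasses (n : ℕ) : (reciprocalClasses p n).Finite := by
  refine ((finite_weight_le (p := p) n).image fun L => ConjClasses.mk (eval L)).subset ?_
  rintro c ⟨⟨g, hgc, hg⟩, hc⟩
  obtain rfl := ConjClasses.mem_carrier_iff_mk_eq.1 hgc
  obtain ⟨L, -, hL, hw⟩ := exists_eval_eq_of_not_isOfFinOrder hg.1
  exact ⟨L, hw.trans (by exact_mod_cast hc), (ConjClasses.mk_eq_mk_iff_isConj.2 hL).symm⟩

theorem ncard_nonprimitive_le (n : ℕ) :
    (reciprocalClasses p n \ primitiveReciprocalClasses p n).ncard ≤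
      {L : List (Letter p) | weight L ≤ n / 4}.ncard *
        (Nat.card (Option (Letter p)) ^ 2 * (n + 1)) := by
  let f : List (Letter p) × (Option (Letter p) × Option (Letter p)) × ℕ →
      ConjClasses (heckeGroup p) := fun t => ConjClasses.mk
        (eval (t.1 ++ t.2.1.1.toList ++ (t.1.map Neg.neg).reverse ++ t.2.1.2.toList) ^ t.2.2)
  let s : Set (List (Letter p) × (Option (Letter p) × Option (Letter p)) × ℕ) :=
    {L : List (Letter p) | weight L ≤ n / 4} ×ˢ
      (Set.univ : Set (Option (Letter p) × Option (Letter p))) ×ˢ Set.Iic n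
  have hs : s.Finite :=
    (finite_weight_le (n / 4)).prod (Set.finite_univ.prod (Set.finite_Iic n))
  have hcard : s.ncard = {L : List (Letter p) | weight L ≤ n / 4}.ncard *
      (Nat.card (Option (Letter p)) ^ 2 * (n + 1)) := by
    rw [Set.ncard_prod, Set.ncard_prod, Set.ncard_univ, Nat.card_prod, sq]
    simp [← Nat.card_coe_set_eq]
  rw [← hcard]
  refine (Set.ncard_le_ncard ?_ (hs.image f)).trans (Set.ncard_image_le hs)
  rintro c ⟨⟨⟨g, hgc, hg⟩, hc⟩, hnp⟩
  obtain rfl := ConjClasses.mem_carrier_iff_mk_eq.1 hgc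
  have hprim : ¬ IsPrimitive g := fun h => hnp ⟨⟨g, hgc, hg, h⟩, hc⟩
  obtain ⟨T, q, r, k, hgk, hk, hT⟩ := hg.exists_isConj_of_not_isPrimitive hprim
  have hc' : classLength (ConjClasses.mk g) ≤ n := by exact_mod_cast hc
  refine ⟨(T, (q, r), k), ⟨?_, Set.mem_univ _, hk.trans hc'⟩,
    (ConjClasses.mk_eq_mk_iff_isConj.2 hgk).symm⟩
  change weight T ≤ n / 4
  omega

/-- T is recovered from the class of T T* and a rotation amount at most n: rotate the chosen
representative of the class into T T* and keep the first half. -/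
theorem ncard_le_ncard_reciprocalClasses_mul (n : ℕ) :
    {T : List (Letter p) | T ≠ [] ∧ 2 * weight T ≤ n}.ncard ≤
      (reciprocalClasses p n).ncard * (n + 1) := by
  let rep : ConjClasses (heckeGroup p) → List (Letter p) :=
    Function.invFun fun L => ConjClasses.mk (eval L)
  let f : ConjClasses (heckeGroup p) × ℕ → List (Letter p) := fun t =>
    ((rep t.1).rotate t.2).take ((rep t.1).length / 2)
  let s : Set (ConjClasses (heckeGroup p) × ℕ) := reciprocalClasses p n ×ˢ Set.Iic n
  have hs : s.Finite := (finite_reciprocalClasses n).prod (Set.finite_Iic n)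
  have hcard : s.ncard = (reciprocalClasses p n).ncard * (n + 1) := by
    rw [Set.ncard_prod]
    simp [← Nat.card_coe_set_eq]
  rw [← hcard]
  refine (Set.ncard_le_ncard ?_ (hs.image f)).trans (Set.ncard_image_le hs)
  rintro T ⟨hT, hTn⟩
  have hne : T ++ (T.map Neg.neg).reverse ≠ [] := by simp [hT]
  have hrev : ((T ++ (T.map Neg.neg).reverse).map Neg.neg).reverse =
      T ++ (T.map Neg.neg).reverse := by simp
  have hw : weight (T ++ (T.map Neg.neg).reverse) ≤ n := by
    rw [weight_append, weight_map_neg_reverse]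
    omega
  have hrep : ConjClasses.mk (eval (rep (ConjClasses.mk (eval (T ++ (T.map Neg.neg).reverse))))) =
      ConjClasses.mk (eval (T ++ (T.map Neg.neg).reverse)) :=
    Function.invFun_eq (f := fun L => ConjClasses.mk (eval L)) ⟨_, rfl⟩
  have hrot := ((isConj_eval_iff hne).1 (ConjClasses.mk_eq_mk_iff_isConj.1 hrep.symm)).symm
  have hlen := hrot.perm.length_eq
  obtain ⟨r, hr, hrT⟩ := List.isRotated_iff_mod.1 hrot
  refine ⟨(ConjClasses.mk (eval (T ++ (T.map Neg.neg).reverse)), r), ⟨⟨⟨_,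
    ConjClasses.mem_carrier_mk, isReciprocal_eval hne hrev⟩, ?_⟩, ?_⟩, ?_⟩
  · exact_mod_cast (classLength_mk_eval_le _).trans hw
  · exact (hr.trans hlen.le).trans ((length_le_weight _).trans hw)
  · change List.take (_ / 2) (List.rotate _ _) = T
    rw [hrT, hlen]
    have : (T ++ (T.map Neg.neg).reverse).length / 2 = T.length := by
      simp
      omega
    rw [this]
    simp

/-- Each L is extended by m letters from {1, -1}, which are distinct as p ≥ 3 and have weight 2
each. The fixed block length makes the extension injective. -/
theorem ncard_mul_two_pow_le {k m n : ℕ} (hm : 0 < m) (h : 2 * (n + 2 * m) ≤ k) :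
    {L : List (Letter p) | weight L ≤ n}.ncard * 2 ^ m ≤
      {T : List (Letter p) | T ≠ [] ∧ 2 * weight T ≤ k}.ncard := by
  let e : Bool → Letter p := fun b =>
    if b then ⟨1, one_ne_zero⟩ else ⟨-1, neg_ne_zero.2 one_ne_zero⟩
  have he : Function.Injective e := by
    have h1 : (1 : ZMod p) ≠ -1 := one_ne_neg_one
    rintro (_ | _) (_ | _) hab
    · rfl
    · exact absurd (congrArg Subtype.val hab).symm h1
    · exact absurd (congrArg Subtype.val hab) h1
    · rfl
  have hnorm : ∀ b, (e b).1.valMinAbs.natAbs = 1 := by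
    rintro (_ | _)
    · exact (ZMod.natAbs_valMinAbs_neg 1).trans natAbs_valMinAbs_one
    · exact natAbs_valMinAbs_one
  let f : List (Letter p) × (Fin m → Bool) → List (Letter p) := fun t =>
    t.1 ++ List.ofFn fun i => e (t.2 i)
  have hf : Function.Injective f := by
    rintro ⟨T, u⟩ ⟨S, v⟩ huv
    obtain ⟨h1, h2⟩ := List.append_inj' huv (by simp)
    exact Prod.ext h1 (funext fun i => he (congrFun (List.ofFn_injective h2) i))
  have hw : ∀ u : Fin m → Bool, weight (List.ofFn fun i => e (u i)) = 2 * m := by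
    intro u
    simp [weight, List.map_ofFn, Function.comp_def, hnorm, mul_comm]
  have hcard : ({L : List (Letter p) | weight L ≤ n} ×ˢ
      (Set.univ : Set (Fin m → Bool))).ncard =
      {L : List (Letter p) | weight L ≤ n}.ncard * 2 ^ m := by
    rw [Set.ncard_prod, Set.ncard_univ]
    simp
  rw [← hcard]
  refine Set.ncard_le_ncard_of_injOn f ?_ hf.injOn
    ((finite_weight_le k).subset fun T hT => ?_)
  · rintro ⟨T, u⟩ ⟨hT, -⟩
    have hT' : weight T ≤ n := hT
    refine ⟨?_, ?_⟩
    · intro h0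
      have := congrArg List.length h0
      simp [f] at this
      omega
    · change 2 * weight (T ++ List.ofFn fun i => e (u i)) ≤ k
      rw [weight_append, hw]
      omega
  · have := hT.2
    change weight T ≤ k
    omega

/-! ### Comparison of the counts and the limit. -/

theorem ncard_reciprocalClasses_bounds {n : ℕ} (hn : 8 ≤ n) :
    0 < (reciprocalClasses p n).ncard ∧
      (reciprocalClasses p n \ primitiveReciprocalClasses p n).ncard * 2 ^ (n / 8) ≤
        (reciprocalClasses p n).ncard * (Nat.card (Option (Letter p)) ^ 2 * (n + 1) ^ 2) := by
  have h1 := ncard_nonprimitive_le (p := p) n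
  have h2 := (ncard_mul_two_pow_le (p := p) (m := n / 8) (n := n / 4) (k := n) (by omega)
    (by omega)).trans (ncard_le_ncard_reciprocalClasses_mul n)
  have h3 : 0 < {L : List (Letter p) | weight L ≤ n / 4}.ncard :=
    (Set.ncard_pos (finite_weight_le _)).2 ⟨[], by simp⟩
  constructor
  · by_contra h
    have h0 : (reciprocalClasses p n).ncard = 0 := by omega
    rw [h0, zero_mul] at h2
    exact absurd h2 (not_le.2 (by positivity))
  · refine (Nat.mul_le_mul_right _ h1).trans ?_
    calc _ = ({L : List (Letter p) | weight L ≤ n / 4}.ncard * 2 ^ (n / 8)) *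
          (Nat.card (Option (Letter p)) ^ 2 * (n + 1)) := by ring
      _ ≤ ((reciprocalClasses p n).ncard * (n + 1)) *
          (Nat.card (Option (Letter p)) ^ 2 * (n + 1)) := Nat.mul_le_mul_right _ h2
      _ = _ := by ring

/-- With m = ⌊x⌋₊ / 8, the constant is 128 = 8² · 2: the square comes from n + 1 ≤ 8(m + 1), the
factor 2 from writing 2^(m+1) in place of 2^m. -/
theorem one_sub_le_ncard_div_ncard {x : ℝ} (hx : 8 ≤ x) :
    1 - 128 * (Nat.card (Option (Letter p)) : ℝ) ^ 2 *
        (((⌊x⌋₊ / 8 + 1 : ℕ) : ℝ) ^ 2 / 2 ^ (⌊x⌋₊ / 8 + 1)) ≤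
      ((primitiveReciprocalClasses p x).ncard : ℝ) / ((reciprocalClasses p x).ncard : ℝ) := by
  have hx0 : 0 ≤ x := by linarith
  rw [reciprocalClasses_natFloor hx0, primitiveReciprocalClasses_natFloor hx0]
  have hn : 8 ≤ ⌊x⌋₊ := Nat.le_floor (by exact_mod_cast hx)
  generalize ⌊x⌋₊ = n at *
  obtain ⟨hpos, hle⟩ := ncard_reciprocalClasses_bounds (p := p) hn
  have hsum := Set.ncard_sdiff_add_ncard_of_subset
    (primitiveReciprocalClasses_subset (p := p) (n : ℝ)) (finite_reciprocalClasses n)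
  have hn8 : (n + 1) ^ 2 ≤ (8 * (n / 8 + 1)) ^ 2 := Nat.pow_le_pow_left (by omega) 2
  have hle' := hle.trans (Nat.mul_le_mul_left _ (Nat.mul_le_mul_left _ hn8))
  generalize (reciprocalClasses p n \ primitiveReciprocalClasses p n).ncard = d at *
  generalize (reciprocalClasses p n).ncard = R at *
  generalize (primitiveReciprocalClasses p n).ncard = P at *
  generalize n / 8 = m at *
  generalize Nat.card (Option (Letter p)) = C at *
  have hR : (0 : ℝ) < R := by exact_mod_cast hpos
  have hP : (P : ℝ) = R - d := by
    rw [← hsum]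
    push_cast
    ring
  have hle2 : (d : ℝ) * 2 ^ m ≤ R * (C ^ 2 * (8 * (m + 1)) ^ 2) := by exact_mod_cast hle'
  rw [hP, sub_div, div_self hR.ne', sub_le_sub_iff_left, div_le_iff₀ hR, mul_div_assoc', div_mul_eq_mul_div,
    le_div_iff₀ (by positivity)]
  push_cast
  rw [pow_succ]
  linarith

end Hecke

theorem corollary1p3 (p : ℕ) (hp : 3 ≤ p) :
    Filter.Tendsto
      (fun x : ℝ => ((Hecke.primitiveReciprocalClasses p x).ncard : ℝ) /
        ((Hecke.reciprocalClasses p x).ncard : ℝ))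
      Filter.atTop (nhds 1) := by
  have : Fact (3 ≤ p) := ⟨hp⟩
  have hm : Filter.Tendsto (fun x : ℝ => ⌊x⌋₊ / 8 + 1) Filter.atTop Filter.atTop :=
    (Filter.tendsto_add_atTop_nat 1).comp
      ((Nat.tendsto_div_const_atTop (by norm_num)).comp tendsto_nat_floor_atTop)
  have hlim := (((tendsto_pow_const_div_const_pow_of_one_lt 2 (one_lt_two (α := ℝ))).comp
    hm).const_mul (128 * (Nat.card (Option (Hecke.Letter p)) : ℝ) ^ 2)).const_sub 1
  rw [mul_zero, sub_zero] at hlim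
  refine tendsto_of_tendsto_of_tendsto_of_le_of_le' hlim tendsto_const_nhds ?_ ?_
  · filter_upwards [Filter.eventually_ge_atTop 8] with x hx
    exact Hecke.one_sub_le_ncard_div_ncard hx
  · filter_upwards [Filter.eventually_ge_atTop 0] with x hx
    refine div_le_one_of_le₀ ?_ (Nat.cast_nonneg _)
    rw [Hecke.reciprocalClasses_natFloor hx, Hecke.primitiveReciprocalClasses_natFloor hx]
    -- Finiteness matters here: `Set.ncard` is 0 on infinite sets, so it is not monotone in general.
    exact_mod_cast Set.ncard_le_ncard (Hecke.primitiveReciprocalClasses_subset _)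
      (Hecke.finite_reciprocalClasses _)
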